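/- Let $H_1=\mathbb C^m$ and $H_2=\mathbb C^n$ be finite-dimensional complex Hilbert spaces with $m,n\ge 1$, and let $d_2=\dim H_2$. For a positive definite matrix $\rho$ on $H_1\otimes H_2$ let $\rho_1=\mathrm{Tr}_2\,\rho$ denote its partial trace on $H_1$, let $S(\rho)=-\mathrm{Tr}\,\rho\log\rho$ denote the von Neumann entropy (and likewise $S(\rho_1)=-\mathrm{Tr}\,\rho_1\log\rho_1$), and for $f(t)=t\log t$ put $$G(\rho)=d_2^{-1}\,\mathrm{Tr}_{12}\, f(d_2\rho)-\mathrm{Tr}_1\, f(\rho_1).$$ Then, for every positive definite $\rho$, $$G(\rho)=\log d_2\;\mathrm{Tr}_{12}\,\rho+\mathrm{Tr}_{12}\,\rho\log\rho-\mathrm{Tr}_1\,\rho_1\log\rho_1 .$$ The map $\rho\mapsto G(\rho)$ is convex, and the map $\rho\mapsto S(\rho)-S(\rho_1)$ is concave, on the convex set of positive definite matrices $\rho$ on $H_1\otimes H_2$ (not necessarily of trace one). -/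

import Mathlib

open scoped ComplexOrder

noncomputable section

/-- The partial trace `ρ₁ = Tr₂ ρ` over the second factor of a matrix `ρ` acting on
`ℂᵐ ⊗ ℂⁿ = ℂ^(m × n)`. -/
def partialTrace₂ {m n : Type*} [Fintype n] (ρ : Matrix (m × n) (m × n) ℂ) : Matrix m m ℂ :=
  Matrix.of fun i j => ∑ k : n, ρ (i, k) (j, k)

/-- `Tr ρ log ρ`, with the matrix logarithm given by the functional calculus. The trace is real
for Hermitian `ρ`, see `coe_traceMulLog`. -/
def traceMulLog {n : Type*} [Fintype n] [DecidableEq n] (ρ : Matrix n n ℂ) : ℝ :=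
  (ρ * cfc Real.log ρ).trace.re

/-- The von Neumann entropy `S(ρ) = - Tr ρ log ρ`. -/
def vonNeumannEntropy {n : Type*} [Fintype n] [DecidableEq n] (ρ : Matrix n n ℂ) : ℝ :=
  - traceMulLog ρ

/-- `Tr f(ρ)`, with `f(ρ)` given by the functional calculus. The trace is real, see
`coe_traceFun`. -/
def traceFun {n : Type*} [Fintype n] [DecidableEq n] (f : ℝ → ℝ) (ρ : Matrix n n ℂ) : ℝ :=
  (cfc f ρ).trace.re

/-- The map `G(ρ) = d₂⁻¹ Tr₁₂ f(d₂ ρ) - Tr₁ f(ρ₁)`, where `d₂` is the dimension of the second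
factor and `ρ₁` is the partial trace. -/
def entropyDifference {m n : Type*} [Fintype m] [DecidableEq m] [Fintype n] [DecidableEq n]
    (f : ℝ → ℝ) (ρ : Matrix (m × n) (m × n) ℂ) : ℝ :=
  (Fintype.card n : ℝ)⁻¹ * traceFun f ((Fintype.card n : ℝ) • ρ) - traceFun f (partialTrace₂ ρ)

theorem coe_re_trace_of_isHermitian {n : Type*} [Fintype n] {A : Matrix n n ℂ}
    (hA : A.IsHermitian) : ((A.trace.re : ℝ) : ℂ) = A.trace := by
  apply Complex.conj_eq_iff_re.mp
  have h := Matrix.trace_conjTranspose A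
  rw [hA.eq] at h
  exact h.symm

theorem coe_traceFun {n : Type*} [Fintype n] [DecidableEq n] (f : ℝ → ℝ) (ρ : Matrix n n ℂ) :
    ((traceFun f ρ : ℝ) : ℂ) = (cfc f ρ).trace :=
  coe_re_trace_of_isHermitian (cfc_predicate f ρ : IsSelfAdjoint (cfc f ρ))

theorem coe_traceMulLog {n : Type*} [Fintype n] [DecidableEq n] {ρ : Matrix n n ℂ}
    (hρ : ρ.IsHermitian) : ((traceMulLog ρ : ℝ) : ℂ) = (ρ * cfc Real.log ρ).trace := by
  apply coe_re_trace_of_isHermitian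
  have h1 : IsSelfAdjoint ρ := hρ
  have h2 : IsSelfAdjoint (cfc Real.log ρ) := cfc_predicate Real.log ρ
  have h3 : Commute ρ (cfc Real.log ρ) := by
    have := cfc_commute_cfc (id : ℝ → ℝ) Real.log ρ
    rwa [cfc_id ℝ ρ h1] at this
  exact (h1.commute_iff h2).mp h3

end

/-!
Up to a linear term, `G(ρ)` is `Tr ρ log ρ - Tr ρ₁ log ρ₁`, and this difference is the relative
entropy `D(ρ ‖ ρ₁ ⊗ 1)`, because `log (ρ₁ ⊗ 1) = log ρ₁ ⊗ 1` and `Tr ρ (M ⊗ 1) = Tr ρ₁ M`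
(`relativeEntropy_partialTrace₂_kronecker_one`). Since `ρ ↦ (ρ, ρ₁ ⊗ 1)` is linear, both convexity
claims follow from the joint convexity of `D(A ‖ B) = Tr A (log A - log B)` on pairs of positive
definite matrices (`convexOn_relativeEntropy`).

Joint convexity rests on the scalar identity
`a log a - a log b - (a - b) = ∫₀¹ s (a - b)² / ((1 - s) a + s b) ds`
(`mul_log_sub_mul_log_eq_integral`). Summed over the eigenvalues `a i` of `A` and `b j` of `B`, with
the squared overlaps of the two eigenbases as weights, it becomes
`D(A ‖ B) = Tr A - Tr B + ∫₀¹ s ⟨A - B, ((1 - s) L_A + s R_B)⁻¹ (A - B)⟩ ds`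
(`relativeEntropy_eq_integral`), with `L_A` and `R_B` the operators of left and right
multiplication on the Hilbert-Schmidt space. Completing the square entrywise in the eigenbases
shows that, for each `s ∈ [0, 1]`, the form under the integral is the maximum over all matrices `X`
of `2 Re ⟨X, A - B⟩ - ⟨X, ((1 - s) L_A + s R_B) X⟩`, which is linear in the pair `(A, B)`. Hence
the form is jointly convex (`entropyDensity_combo_le`), and so is the integral.
-/

noncomputable section

open Matrix Kronecker

/-! ### A scalar integral formula -/

theorem one_sub_mul_add_mul_pos {a b s : ℝ} (ha : 0 < a) (hb : 0 < b) (hs : s ∈ Set.Icc (0 : ℝ) 1) :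
    0 < (1 - s) * a + s * b := by
  rcases hs.1.eq_or_lt with rfl | h
  · simpa using ha
  · have := mul_nonneg (sub_nonneg.2 hs.2) ha.le
    have := mul_pos h hb
    linarith

theorem mul_log_sub_mul_log_eq_integral {a b : ℝ} (ha : 0 < a) (hb : 0 < b) :
    a * Real.log a - a * Real.log b - (a - b) =
      ∫ s in (0 : ℝ)..1, s * ((a - b) ^ 2 / ((1 - s) * a + s * b)) := by
  have hpos : ∀ s ∈ Set.uIcc (0 : ℝ) 1, 0 < (1 - s) * a + s * b := by
    intro s hs
    rw [Set.uIcc_of_le zero_le_one] at hs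
    exact one_sub_mul_add_mul_pos ha hb hs
  have hderiv : ∀ s ∈ Set.uIcc (0 : ℝ) 1,
      HasDerivAt (fun s => -(a - b) * s - a * Real.log ((1 - s) * a + s * b))
        (s * ((a - b) ^ 2 / ((1 - s) * a + s * b))) s := by
    intro s hs
    have h0 := (hpos s hs).ne'
    have h1 : HasDerivAt (fun s : ℝ => (1 - s) * a + s * b) (-1 * a + 1 * b) s :=
      (((hasDerivAt_id s).const_sub 1).mul_const a).add ((hasDerivAt_id s).mul_const b)
    have h2 := ((hasDerivAt_id s).const_mul (-(a - b))).sub ((h1.log h0).const_mul a)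
    refine h2.congr_deriv ?_
    -- With `u = (1 - s) a + s b`, the integrand is `(a - u) (a - b) / u`.
    generalize hu : (1 - s) * a + s * b = u at h0
    have hs' : s * (a - b) = a - u := by rw [← hu]; ring
    rw [sq, mul_div_assoc, ← mul_assoc s, hs']
    field_simp
    ring
  rw [intervalIntegral.integral_eq_sub_of_hasDerivAt hderiv]
  · simp
    ring
  · refine ContinuousOn.intervalIntegrable ?_
    refine continuousOn_id.mul (continuousOn_const.div (by fun_prop) fun s hs => (hpos s hs).ne')

/-! ### The variational functional -/

/-- The functional of which the weighted Hilbert-Schmidt form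
`⟨A - B, ((1 - s) L_A + s R_B)⁻¹ (A - B)⟩` is the maximum over `X`, where `L_A` and `R_B` denote
left and right multiplication. It is linear in the pair `(A, B)`. -/
def quadraticBound {n : Type*} [Fintype n] (s : ℝ) (A B X : Matrix n n ℂ) : ℝ :=
  2 * (Xᴴ * (A - B)).trace.re
    - ((1 - s) * (Xᴴ * (A * X)).trace.re + s * (X * B * Xᴴ).trace.re)

theorem quadraticBound_combo {n : Type*} [Fintype n] (s : ℝ)
    (A₁ A₂ B₁ B₂ X : Matrix n n ℂ) (p q : ℝ) :
    quadraticBound s (p • A₁ + q • A₂) (p • B₁ + q • B₂) X =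
      p * quadraticBound s A₁ B₁ X + q * quadraticBound s A₂ B₂ X := by
  have h : p • A₁ + q • A₂ - (p • B₁ + q • B₂) = p • (A₁ - B₁) + q • (A₂ - B₂) := by
    simp only [smul_sub]; abel
  simp only [quadraticBound, h, Matrix.mul_add, Matrix.add_mul, Matrix.mul_smul, Matrix.smul_mul,
    trace_add, trace_smul, Complex.add_re, Complex.smul_re, smul_eq_mul]
  ring

section Diagonalization

variable {n : Type*} [Fintype n] [DecidableEq n]

theorem trace_conj_diagonal_mul_conj_diagonal (U V : Matrix n n ℂ) (f g : n → ℝ) :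
    (U * diagonal (fun i => (f i : ℂ)) * Uᴴ * (V * diagonal (fun i => (g i : ℂ)) * Vᴴ)).trace.re =
      ∑ i, ∑ j, ‖(Uᴴ * V) i j‖ ^ 2 * (f i * g j) := by
  have h : (U * diagonal (fun i => (f i : ℂ)) * Uᴴ *
      (V * diagonal (fun i => (g i : ℂ)) * Vᴴ)).trace =
      (diagonal (fun i => (f i : ℂ)) * (Uᴴ * V) * (diagonal (fun i => (g i : ℂ)) *
        (Uᴴ * V)ᴴ)).trace := by
    simp only [conjTranspose_mul, conjTranspose_conjTranspose, Matrix.mul_assoc]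
    rw [Matrix.trace_mul_comm]
    simp only [Matrix.mul_assoc]
  rw [h, Matrix.trace]
  simp only [diag_apply, Matrix.mul_apply (M := diagonal _ * (Uᴴ * V)), diagonal_mul,
    conjTranspose_apply, Complex.re_sum]
  refine Finset.sum_congr rfl fun i _ => Finset.sum_congr rfl fun j _ => ?_
  rw [Complex.sq_norm, Complex.normSq_apply]
  simp
  ring

/-- Writing `X = U Y Vᴴ`, where `U` and `V` diagonalize `A` and `B`, decouples `quadraticBound` into
one quadratic polynomial for each entry of `Y`. -/
theorem quadraticBound_conj_diagonal (s : ℝ) {U V : Matrix n n ℂ}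
    (hU : Uᴴ * U = 1) (hV : Vᴴ * V = 1) (Y : Matrix n n ℂ) (a b : n → ℝ) :
    quadraticBound s (U * diagonal (fun i => (a i : ℂ)) * Uᴴ)
        (V * diagonal (fun i => (b i : ℂ)) * Vᴴ) (U * Y * Vᴴ) =
      ∑ i, ∑ j, (2 * (a i - b j) * (star (Y i j) * (Uᴴ * V) i j).re
        - ((1 - s) * a i + s * b j) * ‖Y i j‖ ^ 2) := by
  have hU' (M : Matrix n n ℂ) : Uᴴ * (U * M) = M := by rw [← Matrix.mul_assoc, hU, Matrix.one_mul]
  have hV' (M : Matrix n n ℂ) : Vᴴ * (V * M) = M := by rw [← Matrix.mul_assoc, hV, Matrix.one_mul]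
  set D := diagonal (fun i => (a i : ℂ)) with hD
  set E := diagonal (fun i => (b i : ℂ)) with hE
  have h1 : ((U * Y * Vᴴ)ᴴ * (U * D * Uᴴ - V * E * Vᴴ)).trace =
      (Yᴴ * (D * (Uᴴ * V) - (Uᴴ * V) * E)).trace := by
    simp only [conjTranspose_mul, conjTranspose_conjTranspose, Matrix.mul_assoc, Matrix.mul_sub,
      trace_sub, hU']
    congr 1 <;> rw [Matrix.trace_mul_comm] <;> simp only [Matrix.mul_assoc, hV, Matrix.mul_one]
  have h2 : ((U * Y * Vᴴ)ᴴ * (U * D * Uᴴ * (U * Y * Vᴴ))).trace = (Yᴴ * (D * Y)).trace := by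
    simp only [conjTranspose_mul, conjTranspose_conjTranspose, Matrix.mul_assoc, hU']
    rw [Matrix.trace_mul_comm]
    simp only [Matrix.mul_assoc, hV, Matrix.mul_one]
  have h3 : ((U * Y * Vᴴ) * (V * E * Vᴴ) * (U * Y * Vᴴ)ᴴ).trace = (Yᴴ * (Y * E)).trace := by
    simp only [conjTranspose_mul, conjTranspose_conjTranspose, Matrix.mul_assoc, hV']
    rw [Matrix.trace_mul_comm]
    simp only [Matrix.mul_assoc, hU, Matrix.mul_one]
    rw [← Matrix.mul_assoc, Matrix.trace_mul_comm]
  rw [quadraticBound, h1, h2, h3]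
  simp only [Matrix.trace, diag_apply, Matrix.mul_apply (M := Yᴴ), hD, hE, diagonal_mul,
    mul_diagonal, Matrix.sub_apply, conjTranspose_apply, Complex.re_sum, Finset.mul_sum,
    ← Finset.sum_add_distrib, ← Finset.sum_sub_distrib]
  rw [Finset.sum_comm]
  refine Finset.sum_congr rfl fun i _ => Finset.sum_congr rfl fun j _ => ?_
  rw [Complex.sq_norm, Complex.normSq_apply]
  simp
  ring

end Diagonalization

/-! ### Relative entropy -/

theorem convex_setOf_posDef {n : Type*} : Convex ℝ {A : Matrix n n ℂ | A.PosDef} := by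
  intro A hA B hB p q hp hq hpq
  rcases hp.eq_or_lt with rfl | hp
  · obtain rfl : q = 1 := by linarith
    simpa using hB
  · exact (hA.smul hp).add_posSemidef (hB.posSemidef.smul hq)

section RelativeEntropy

variable {n : Type*} [Fintype n] [DecidableEq n] {A B : Matrix n n ℂ}

theorem Matrix.IsHermitian.cfc_eq_conj_diagonal (hA : A.IsHermitian) (f : ℝ → ℝ) :
    cfc f A = (hA.eigenvectorUnitary : Matrix n n ℂ) *
      diagonal (fun i => ((f (hA.eigenvalues i) : ℝ) : ℂ)) *
      (hA.eigenvectorUnitary : Matrix n n ℂ)ᴴ := by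
  rw [hA.cfc_eq, Matrix.IsHermitian.cfc, Unitary.conjStarAlgAut_apply]
  rfl

theorem Matrix.IsHermitian.eq_conj_diagonal (hA : A.IsHermitian) :
    A = (hA.eigenvectorUnitary : Matrix n n ℂ) *
      diagonal (fun i => (hA.eigenvalues i : ℂ)) *
      (hA.eigenvectorUnitary : Matrix n n ℂ)ᴴ := by
  conv_lhs => rw [hA.spectral_theorem, Unitary.conjStarAlgAut_apply]
  rfl

/-- The matrix of overlaps `⟨e i, f j⟩` of the eigenbases of two Hermitian matrices. -/
def eigenbasisOverlap (hA : A.IsHermitian) (hB : B.IsHermitian) : Matrix n n ℂ :=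
  (hA.eigenvectorUnitary : Matrix n n ℂ)ᴴ * (hB.eigenvectorUnitary : Matrix n n ℂ)

theorem trace_cfc_mul_cfc (hA : A.IsHermitian) (hB : B.IsHermitian) (f g : ℝ → ℝ) :
    (cfc f A * cfc g B).trace.re = ∑ i, ∑ j, ‖eigenbasisOverlap hA hB i j‖ ^ 2 *
      (f (hA.eigenvalues i) * g (hB.eigenvalues j)) := by
  rw [IsHermitian.cfc_eq_conj_diagonal hA, IsHermitian.cfc_eq_conj_diagonal hB,
    trace_conj_diagonal_mul_conj_diagonal]
  rfl

/-- The weighted Hilbert-Schmidt form `⟨A - B, ((1 - s) L_A + s R_B)⁻¹ (A - B)⟩`, written in the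
eigenbases of `A` and `B`. -/
def entropyDensity (hA : A.IsHermitian) (hB : B.IsHermitian) (s : ℝ) : ℝ :=
  ∑ i, ∑ j, ‖eigenbasisOverlap hA hB i j‖ ^ 2 *
    ((hA.eigenvalues i - hB.eigenvalues j) ^ 2 /
      ((1 - s) * hA.eigenvalues i + s * hB.eigenvalues j))

theorem quadraticBound_le_entropyDensity (hA : A.PosDef) (hB : B.PosDef) {s : ℝ}
    (hs : s ∈ Set.Icc (0 : ℝ) 1) (X : Matrix n n ℂ) :
    quadraticBound s A B X ≤ entropyDensity hA.1 hB.1 s := by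
  let U : Matrix n n ℂ := (hA.1.eigenvectorUnitary : Matrix n n ℂ)
  let V : Matrix n n ℂ := (hB.1.eigenvectorUnitary : Matrix n n ℂ)
  have hU : Uᴴ * U = 1 := Unitary.coe_star_mul_self hA.1.eigenvectorUnitary
  have hV : Vᴴ * V = 1 := Unitary.coe_star_mul_self hB.1.eigenvectorUnitary
  have hU2 : U * Uᴴ = 1 := Unitary.coe_mul_star_self hA.1.eigenvectorUnitary
  have hV2 : V * Vᴴ = 1 := Unitary.coe_mul_star_self hB.1.eigenvectorUnitary
  have hX : X = U * (Uᴴ * X * V) * Vᴴ := by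
    simp only [← Matrix.mul_assoc, hU2, Matrix.one_mul]
    rw [Matrix.mul_assoc, hV2, Matrix.mul_one]
  have key := quadraticBound_conj_diagonal s hU hV (Uᴴ * X * V) hA.1.eigenvalues hB.1.eigenvalues
  rw [← hX, ← IsHermitian.eq_conj_diagonal hA.1, ← IsHermitian.eq_conj_diagonal hB.1] at key
  rw [key]
  refine Finset.sum_le_sum fun i _ => Finset.sum_le_sum fun j _ => ?_
  have hc := one_sub_mul_add_mul_pos (hA.eigenvalues_pos i) (hB.eigenvalues_pos j) hs
  change _ ≤ ‖(Uᴴ * V) i j‖ ^ 2 * _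
  generalize (Uᴴ * X * V) i j = y
  generalize (Uᴴ * V) i j = w
  generalize hA.1.eigenvalues i - hB.1.eigenvalues j = d
  generalize (1 - s) * hA.1.eigenvalues i + s * hB.1.eigenvalues j = c at hc
  -- After clearing the denominator `c`, the difference of the two sides is `|c y - d w|²`.
  rw [← mul_div_assoc, le_div_iff₀ hc, Complex.sq_norm, Complex.sq_norm, Complex.normSq_apply,
    Complex.normSq_apply]
  simp
  nlinarith [sq_nonneg (c * y.re - d * w.re), sq_nonneg (c * y.im - d * w.im)]

theorem exists_quadraticBound_eq_entropyDensity (hA : A.PosDef) (hB : B.PosDef) {s : ℝ}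
    (hs : s ∈ Set.Icc (0 : ℝ) 1) :
    ∃ X, quadraticBound s A B X = entropyDensity hA.1 hB.1 s := by
  let U : Matrix n n ℂ := (hA.1.eigenvectorUnitary : Matrix n n ℂ)
  let V : Matrix n n ℂ := (hB.1.eigenvectorUnitary : Matrix n n ℂ)
  have hU : Uᴴ * U = 1 := Unitary.coe_star_mul_self hA.1.eigenvectorUnitary
  have hV : Vᴴ * V = 1 := Unitary.coe_star_mul_self hB.1.eigenvectorUnitary
  -- The entrywise maximizer of `2 d Re (star y * w) - c |y|²` is `y = (d / c) w`.
  let Y : Matrix n n ℂ := of fun i j =>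
    (((hA.1.eigenvalues i - hB.1.eigenvalues j) /
      ((1 - s) * hA.1.eigenvalues i + s * hB.1.eigenvalues j) : ℝ) : ℂ) * (Uᴴ * V) i j
  refine ⟨U * Y * Vᴴ, ?_⟩
  have key := quadraticBound_conj_diagonal s hU hV Y hA.1.eigenvalues hB.1.eigenvalues
  rw [← IsHermitian.eq_conj_diagonal hA.1, ← IsHermitian.eq_conj_diagonal hB.1] at key
  rw [key]
  refine Finset.sum_congr rfl fun i _ => Finset.sum_congr rfl fun j _ => ?_
  have hc := one_sub_mul_add_mul_pos (hA.eigenvalues_pos i) (hB.eigenvalues_pos j) hs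
  change _ = ‖(Uᴴ * V) i j‖ ^ 2 * _
  simp only [Y, of_apply]
  generalize (Uᴴ * V) i j = w
  generalize hA.1.eigenvalues i - hB.1.eigenvalues j = d
  generalize (1 - s) * hA.1.eigenvalues i + s * hB.1.eigenvalues j = c at hc
  rw [Complex.sq_norm, Complex.sq_norm, Complex.normSq_apply, Complex.normSq_apply]
  simp only [Complex.star_def, map_mul, Complex.conj_ofReal, Complex.mul_re, Complex.mul_im,
    Complex.ofReal_re, Complex.ofReal_im, Complex.conj_re, Complex.conj_im]
  field_simp
  ring

/-- For each `s`, the form `entropyDensity` is jointly convex, being a maximum of linear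
functions. -/
theorem entropyDensity_combo_le {A₁ A₂ B₁ B₂ : Matrix n n ℂ} (hA₁ : A₁.PosDef) (hA₂ : A₂.PosDef)
    (hB₁ : B₁.PosDef) (hB₂ : B₂.PosDef) {p q : ℝ} (hp : 0 ≤ p) (hq : 0 ≤ q)
    (hA : (p • A₁ + q • A₂).PosDef) (hB : (p • B₁ + q • B₂).PosDef) {s : ℝ}
    (hs : s ∈ Set.Icc (0 : ℝ) 1) :
    entropyDensity hA.1 hB.1 s ≤
      p * entropyDensity hA₁.1 hB₁.1 s + q * entropyDensity hA₂.1 hB₂.1 s := by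
  obtain ⟨X, hX⟩ := exists_quadraticBound_eq_entropyDensity hA hB hs
  rw [← hX, quadraticBound_combo]
  gcongr
  · exact quadraticBound_le_entropyDensity hA₁ hB₁ hs X
  · exact quadraticBound_le_entropyDensity hA₂ hB₂ hs X

theorem continuousOn_entropyDensity (hA : A.PosDef) (hB : B.PosDef) :
    ContinuousOn (entropyDensity hA.1 hB.1) (Set.Icc 0 1) := by
  refine continuousOn_finsetSum _ fun i _ => continuousOn_finsetSum _ fun j _ =>
    continuousOn_const.mul (continuousOn_const.div (by fun_prop) fun s hs => ?_)
  exact (one_sub_mul_add_mul_pos (hA.eigenvalues_pos i) (hB.eigenvalues_pos j) hs).ne'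

/-- The relative entropy `D(A ‖ B) = Tr A (log A - log B)`. -/
def relativeEntropy (A B : Matrix n n ℂ) : ℝ :=
  traceMulLog A - (A * cfc Real.log B).trace.re

theorem relativeEntropy_eq_integral (hA : A.PosDef) (hB : B.PosDef) :
    relativeEntropy A B = A.trace.re - B.trace.re +
      ∫ s in (0 : ℝ)..1, s * entropyDensity hA.1 hB.1 s := by
  have hAs : IsSelfAdjoint A := hA.1
  have hBs : IsSelfAdjoint B := hB.1
  have hfin (f : ℝ → ℝ) : ContinuousOn f (spectrum ℝ A) := A.finite_real_spectrum.continuousOn f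
  -- Each trace is put in the form `Tr f(A) g(B)`, so that all become sums with the same weights.
  have h1 : (A * cfc Real.log A).trace.re = (cfc (fun t => t * Real.log t) A *
      cfc (fun _ : ℝ => (1 : ℝ)) B).trace.re := by
    rw [cfc_mul (fun t => t) Real.log A (hfin _) (hfin _), cfc_id' ℝ A, cfc_const_one ℝ B, mul_one]
  have h2 : (A * cfc Real.log B).trace.re = (cfc (fun t : ℝ => t) A * cfc Real.log B).trace.re := by
    rw [cfc_id' ℝ A]
  have h3 : A.trace.re = (cfc (fun t : ℝ => t) A * cfc (fun _ : ℝ => (1 : ℝ)) B).trace.re := by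
    rw [cfc_id' ℝ A, cfc_const_one ℝ B, mul_one]
  have h4 : B.trace.re = (cfc (fun _ : ℝ => (1 : ℝ)) A * cfc (fun t : ℝ => t) B).trace.re := by
    rw [cfc_id' ℝ B, cfc_const_one ℝ A, one_mul]
  rw [relativeEntropy, traceMulLog, h1, h2, h3, h4]
  simp only [trace_cfc_mul_cfc hA.1 hB.1]
  have hint (i j : n) : IntervalIntegrable (fun s : ℝ =>
      ‖eigenbasisOverlap hA.1 hB.1 i j‖ ^ 2 * (s *
        ((hA.1.eigenvalues i - hB.1.eigenvalues j) ^ 2 /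
          ((1 - s) * hA.1.eigenvalues i + s * hB.1.eigenvalues j)))) MeasureTheory.volume 0 1 := by
    refine ContinuousOn.intervalIntegrable ?_
    rw [Set.uIcc_of_le zero_le_one]
    refine continuousOn_const.mul (continuousOn_id.mul
      (continuousOn_const.div (by fun_prop) fun s hs => ?_))
    exact (one_sub_mul_add_mul_pos (hA.eigenvalues_pos i) (hB.eigenvalues_pos j) hs).ne'
  have hI : ∫ s in (0 : ℝ)..1, s * entropyDensity hA.1 hB.1 s =
      ∑ i, ∑ j, ‖eigenbasisOverlap hA.1 hB.1 i j‖ ^ 2 *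
        ∫ s in (0 : ℝ)..1, s * ((hA.1.eigenvalues i - hB.1.eigenvalues j) ^ 2 /
          ((1 - s) * hA.1.eigenvalues i + s * hB.1.eigenvalues j)) := by
    simp only [entropyDensity, Finset.mul_sum, mul_left_comm _ (‖_‖ ^ 2)]
    rw [intervalIntegral.integral_finsetSum fun i _ => ?_]
    swap
    · simpa only [Finset.sum_fn] using IntervalIntegrable.sum Finset.univ fun j _ => hint i j
    refine Finset.sum_congr rfl fun i _ => ?_
    rw [intervalIntegral.integral_finsetSum fun j _ => hint i j]
    simp only [intervalIntegral.integral_const_mul]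
  rw [hI]
  simp only [← Finset.sum_add_distrib, ← Finset.sum_sub_distrib]
  refine Finset.sum_congr rfl fun i _ => Finset.sum_congr rfl fun j _ => ?_
  rw [← mul_log_sub_mul_log_eq_integral (hA.eigenvalues_pos i) (hB.eigenvalues_pos j)]
  ring

/-- The relative entropy is jointly convex, because its integrand is, by `entropyDensity_combo_le`,
and the terms outside the integral are linear. -/
theorem convexOn_relativeEntropy :
    ConvexOn ℝ ({A : Matrix n n ℂ | A.PosDef} ×ˢ {B : Matrix n n ℂ | B.PosDef})
      (fun P => relativeEntropy P.1 P.2) := by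
  refine ⟨convex_setOf_posDef.prod convex_setOf_posDef, ?_⟩
  rintro ⟨A₁, B₁⟩ ⟨hA₁, hB₁⟩ ⟨A₂, B₂⟩ ⟨hA₂, hB₂⟩ p q hp hq hpq
  have hA : (p • A₁ + q • A₂).PosDef := convex_setOf_posDef hA₁ hA₂ hp hq hpq
  have hB : (p • B₁ + q • B₂).PosDef := convex_setOf_posDef hB₁ hB₂ hp hq hpq
  change A₁.PosDef at hA₁
  change A₂.PosDef at hA₂
  change B₁.PosDef at hB₁
  change B₂.PosDef at hB₂
  change relativeEntropy (p • A₁ + q • A₂) (p • B₁ + q • B₂) ≤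
    p * relativeEntropy A₁ B₁ + q * relativeEntropy A₂ B₂
  have hint {A B : Matrix n n ℂ} (hA : A.PosDef) (hB : B.PosDef) :
      IntervalIntegrable (fun s => s * entropyDensity hA.1 hB.1 s) MeasureTheory.volume 0 1 := by
    refine ContinuousOn.intervalIntegrable ?_
    rw [Set.uIcc_of_le zero_le_one]
    exact continuousOn_id.mul (continuousOn_entropyDensity hA hB)
  have hmono : ∫ s in (0 : ℝ)..1, s * entropyDensity hA.1 hB.1 s ≤
      ∫ s in (0 : ℝ)..1, (p * (s * entropyDensity hA₁.1 hB₁.1 s) +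
        q * (s * entropyDensity hA₂.1 hB₂.1 s)) := by
    refine intervalIntegral.integral_mono_on zero_le_one (hint hA hB)
      (((hint hA₁ hB₁).const_mul p).add ((hint hA₂ hB₂).const_mul q)) fun s hs => ?_
    have := mul_le_mul_of_nonneg_left
      (entropyDensity_combo_le hA₁ hA₂ hB₁ hB₂ hp hq hA hB hs) hs.1
    linarith
  rw [intervalIntegral.integral_add ((hint hA₁ hB₁).const_mul p) ((hint hA₂ hB₂).const_mul q),
    intervalIntegral.integral_const_mul, intervalIntegral.integral_const_mul] at hmono
  rw [relativeEntropy_eq_integral hA hB, relativeEntropy_eq_integral hA₁ hB₁,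
    relativeEntropy_eq_integral hA₂ hB₂]
  simp only [trace_add, trace_smul, Complex.add_re, Complex.smul_re, smul_eq_mul]
  linarith

end RelativeEntropy

/-! ### Partial trace -/

theorem partialTrace₂_eq_sum {m n : Type*} [Fintype n]
    (ρ : Matrix (m × n) (m × n) ℂ) :
    partialTrace₂ ρ = ∑ k : n, ρ.submatrix (fun i => (i, k)) (fun i => (i, k)) := by
  ext i j
  simp [partialTrace₂, Matrix.sum_apply]

theorem trace_mul_kronecker_one {m n : Type*} [Fintype m] [Fintype n] [DecidableEq n]
    (ρ : Matrix (m × n) (m × n) ℂ) (M : Matrix m m ℂ) :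
    (ρ * (M ⊗ₖ (1 : Matrix n n ℂ))).trace = (partialTrace₂ ρ * M).trace := by
  simp only [Matrix.trace, diag_apply, Matrix.mul_apply, Fintype.sum_prod_type, kronecker_apply,
    partialTrace₂, of_apply, one_apply, mul_ite, mul_one, mul_zero, Finset.sum_ite_eq',
    Finset.mem_univ, if_true, Finset.sum_mul]
  exact Finset.sum_congr rfl fun i _ => Finset.sum_comm

theorem posDef_partialTrace₂ {m n : Type*} [Fintype n] [Nonempty n]
    {ρ : Matrix (m × n) (m × n) ℂ} (hρ : ρ.PosDef) :
    (partialTrace₂ ρ).PosDef := by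
  rw [partialTrace₂_eq_sum]
  refine Finset.sum_induction_nonempty _ PosDef (fun _ _ ha hb => ha.add hb)
    Finset.univ_nonempty fun k _ => hρ.submatrix fun i j h => ?_
  simpa using h

section PartialTrace

variable {m n : Type*} [Fintype m] [DecidableEq m] [Fintype n] [DecidableEq n]

/-- The embedding `M ↦ M ⊗ 1` of matrix algebras. -/
def kroneckerOneHom (m n : Type*) [Fintype m] [DecidableEq m] [Fintype n] [DecidableEq n] :
    Matrix m m ℂ →⋆ₐ[ℝ] Matrix (m × n) (m × n) ℂ where
  toFun M := M ⊗ₖ (1 : Matrix n n ℂ)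
  map_one' := one_kronecker_one
  map_mul' M N := by rw [← mul_kronecker_mul, one_mul]
  map_zero' := zero_kronecker _
  map_add' M N := add_kronecker _ _ _
  commutes' r := by
    rw [Algebra.algebraMap_eq_smul_one, Algebra.algebraMap_eq_smul_one, smul_kronecker,
      one_kronecker_one]
  map_star' M := by
    rw [star_eq_conjTranspose, star_eq_conjTranspose, conjTranspose_kronecker, conjTranspose_one]

theorem cfc_kronecker_one {M : Matrix m m ℂ} (hM : M.IsHermitian) (f : ℝ → ℝ) :
    cfc f (M ⊗ₖ (1 : Matrix n n ℂ)) = cfc f M ⊗ₖ (1 : Matrix n n ℂ) := by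
  have hcont : Continuous (kroneckerOneHom m n) :=
    LinearMap.continuous_of_finiteDimensional (kroneckerOneHom m n).toAlgHom.toLinearMap
  have hM' : IsSelfAdjoint M := hM
  exact ((kroneckerOneHom m n).map_cfc f M (M.finite_real_spectrum.continuousOn f) hcont hM'
    (hM'.map _)).symm

/-- `Tr ρ log ρ - Tr ρ₁ log ρ₁` is the relative entropy of `ρ` with respect to `ρ₁ ⊗ 1`. -/
theorem relativeEntropy_partialTrace₂_kronecker_one {ρ : Matrix (m × n) (m × n) ℂ}
    (hρ : (partialTrace₂ ρ).IsHermitian) :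
    relativeEntropy ρ (partialTrace₂ ρ ⊗ₖ (1 : Matrix n n ℂ)) =
      traceMulLog ρ - traceMulLog (partialTrace₂ ρ) := by
  rw [relativeEntropy, cfc_kronecker_one hρ, trace_mul_kronecker_one]
  rfl

theorem convexOn_traceMulLog_sub_partialTrace₂ :
    ConvexOn ℝ {ρ : Matrix (m × n) (m × n) ℂ | ρ.PosDef}
      (fun ρ => traceMulLog ρ - traceMulLog (partialTrace₂ ρ)) := by
  cases isEmpty_or_nonempty n
  · -- All matrices indexed by the empty type coincide.
    have h : (fun ρ : Matrix (m × n) (m × n) ℂ => traceMulLog ρ - traceMulLog (partialTrace₂ ρ)) =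
        fun _ => traceMulLog (0 : Matrix (m × n) (m × n) ℂ) -
          traceMulLog (partialTrace₂ (0 : Matrix (m × n) (m × n) ℂ)) := by
      funext ρ
      rw [Subsingleton.elim ρ 0]
    rw [h]
    exact convexOn_const _ convex_setOf_posDef
  · let T : Matrix (m × n) (m × n) ℂ →ₗ[ℝ]
        Matrix (m × n) (m × n) ℂ × Matrix (m × n) (m × n) ℂ :=
      { toFun := fun ρ => (ρ, partialTrace₂ ρ ⊗ₖ (1 : Matrix n n ℂ))
        map_add' := fun ρ σ => by
          ext <;> simp [partialTrace₂, Finset.sum_add_distrib, add_mul]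
        map_smul' := fun c ρ => by
          ext <;> simp [partialTrace₂, ← Finset.mul_sum, mul_assoc] }
    refine ((convexOn_relativeEntropy.comp_linearMap T).subset (fun ρ hρ => ?_)
      convex_setOf_posDef).congr fun ρ hρ =>
        relativeEntropy_partialTrace₂_kronecker_one (posDef_partialTrace₂ hρ).1
    exact ⟨hρ, (posDef_partialTrace₂ hρ).kronecker PosDef.one⟩

theorem traceFun_mul_log {A : Matrix m m ℂ} (hA : A.IsHermitian) :
    traceFun (fun t => t * Real.log t) A = traceMulLog A := by
  have hA' : IsSelfAdjoint A := hA
  rw [traceFun, traceMulLog, cfc_mul (fun t => t) Real.log A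
    (A.finite_real_spectrum.continuousOn _) (A.finite_real_spectrum.continuousOn _), cfc_id' ℝ A]

theorem traceFun_mul_log_smul {A : Matrix m m ℂ} (hA : A.PosDef) {c : ℝ} (hc : c ≠ 0) :
    traceFun (fun t => t * Real.log t) (c • A) =
      c * (Real.log c * A.trace.re + traceMulLog A) := by
  have hA' : IsSelfAdjoint A := hA.1
  have hfin (f : ℝ → ℝ) : ContinuousOn f (spectrum ℝ A) := A.finite_real_spectrum.continuousOn f
  have hcfc : cfc (fun t => t * Real.log t) (c • A) =
      (c * Real.log c) • A + c • cfc (fun t => t * Real.log t) A := by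
    rw [← cfc_comp_smul c (fun t => t * Real.log t) A
      ((A.finite_real_spectrum.image _).continuousOn _)]
    have : Set.EqOn (fun t => c • t * Real.log (c • t))
        (fun t => (c * Real.log c) • t + c • (t * Real.log t)) (spectrum ℝ A) := by
      intro t ht
      rw [hA.1.spectrum_real_eq_range_eigenvalues] at ht
      obtain ⟨i, rfl⟩ := ht
      have := (hA.eigenvalues_pos i).ne'
      simp only [smul_eq_mul, Real.log_mul hc this]
      ring
    rw [cfc_congr this, cfc_add A _ _ (hfin _) (hfin _), cfc_smul _ _ A (hfin _),
      cfc_smul _ _ A (hfin _), cfc_id' ℝ A]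
  rw [← traceFun_mul_log hA.1, traceFun, hcfc, traceFun]
  simp only [trace_add, trace_smul, Complex.add_re, Complex.smul_re, smul_eq_mul]
  ring

theorem entropyDifference_mul_log {ρ : Matrix (m × n) (m × n) ℂ} (hρ : ρ.PosDef) :
    entropyDifference (fun t : ℝ => t * Real.log t) ρ =
      Real.log (Fintype.card n) * ρ.trace.re + traceMulLog ρ
        - traceMulLog (partialTrace₂ ρ) := by
  have h₁ : (partialTrace₂ ρ).IsHermitian := by
    rw [partialTrace₂_eq_sum]
    exact isSelfAdjoint_sum _ fun k _ => hρ.1.submatrix _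
  rw [entropyDifference, traceFun_mul_log h₁]
  cases isEmpty_or_nonempty n
  · -- Here `d₂ = 0`, and the traces over the zero space vanish.
    simp [traceMulLog, Matrix.trace]
  · have hd : (Fintype.card n : ℝ) ≠ 0 := Nat.cast_ne_zero.2 Fintype.card_ne_zero
    rw [traceFun_mul_log_smul hρ hd, inv_mul_cancel_left₀ hd]

end PartialTrace

end

theorem mainTheorem2 {m n : Type*} [Fintype m] [DecidableEq m] [Fintype n] [DecidableEq n] :
    (∀ ρ : Matrix (m × n) (m × n) ℂ, ρ.PosDef →
      entropyDifference (fun t : ℝ => t * Real.log t) ρ =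
        Real.log (Fintype.card n) * ρ.trace.re + traceMulLog ρ
          - traceMulLog (partialTrace₂ ρ)) ∧
    ConvexOn ℝ {ρ : Matrix (m × n) (m × n) ℂ | ρ.PosDef}
      (entropyDifference (fun t : ℝ => t * Real.log t)) ∧
    ConcaveOn ℝ {ρ : Matrix (m × n) (m × n) ℂ | ρ.PosDef}
      (fun ρ => vonNeumannEntropy ρ - vonNeumannEntropy (partialTrace₂ ρ)) := by
  have hconv := convexOn_traceMulLog_sub_partialTrace₂ (m := m) (n := n)
  refine ⟨fun ρ hρ => entropyDifference_mul_log hρ, ?_, ?_⟩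
  · let ℓ : Matrix (m × n) (m × n) ℂ →ₗ[ℝ] ℝ :=
      Real.log (Fintype.card n) • Complex.reLm ∘ₗ Matrix.traceLinearMap (m × n) ℝ ℂ
    refine ((ℓ.convexOn convex_setOf_posDef).add hconv).congr fun ρ hρ => ?_
    rw [entropyDifference_mul_log hρ]
    simp [ℓ]
    ring
  · refine hconv.neg.congr fun ρ _ => ?_
    simp only [Pi.neg_apply, vonNeumannEntropy]
    ring
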